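/- Let $n\ge 3$ and let $W=(w_{ij})$ be the random $n\times n$ edge-weight matrix of a directed graph on $n$ vertices with $w_{ii}=0$, whose off-diagonal entries $w_{ij}$ ($i\ne j$) are independent and $w_{ij}$ has the $\mathrm{Beta}(a_i,b_j)$ distribution, where $a_1,\dots,a_n>0$ and $b_1,\dots,b_n>0$. Put $R_i=\sum_{j\ne i}\ln w_{ij}$ and $C_j=\sum_{i\ne j}\ln(1-w_{ij})$, and let $\psi(x)=\Gamma'(x)/\Gamma(x)$, $x>0$, be the digamma function. Then, with probability $1$, the system of maximum likelihood equations $$\sum_{j\ne i}\psi(\hat a_i+\hat b_j)-(n-1)\psi(\hat a_i)+R_i=0,\qquad i=1,\dots,n,$$ $$\sum_{i\ne j}\psi(\hat a_i+\hat b_j)-(n-1)\psi(\hat b_j)+C_j=0,\qquad j=1,\dots,n,$$ has exactly one solution $(\hat a,\hat b)=(\hat a_1,\dots,\hat a_n,\hat b_1,\dots,\hat b_n)$ with all coordinates positive. -/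

import Mathlib

open MeasureTheory ProbabilityTheory

/-- The digamma function `ψ x = Γ'(x) / Γ(x)` of a real variable (used for `x > 0` only). -/
noncomputable def realDigamma (x : ℝ) : ℝ := deriv Real.Gamma x / Real.Gamma x

/-- `w` is the random edge-weight matrix of the beta directed graph model on `n` vertices with
parameters `a`, `b`: the diagonal is zero, the off-diagonal weights are independent, and the weight
of the edge `i → j` (`i ≠ j`) has the `Beta(a i, b j)` distribution. -/
structure IsBetaDigraph {n : ℕ} {Ω : Type*} [MeasurableSpace Ω] (μ : Measure Ω)
    (a b : Fin n → ℝ) (w : Fin n → Fin n → Ω → ℝ) : Prop where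
  diag : ∀ i ω, w i i ω = 0
  law : ∀ i j, i ≠ j → HasLaw (w i j) (betaMeasure (a i) (b j)) μ
  indep : iIndepFun (fun p : {p : Fin n × Fin n // p.1 ≠ p.2} => w p.1.1 p.1.2) μ

/-- Row sums `R i = ∑_{j ≠ i} log (W i j)` of the matrix of log-weights. -/
noncomputable def rowSum {n : ℕ} (W : Fin n → Fin n → ℝ) (i : Fin n) : ℝ :=
  ∑ j ∈ Finset.univ.filter (fun j => j ≠ i), Real.log (W i j)

/-- Column sums `C j = ∑_{i ≠ j} log (1 - W i j)` of the matrix of complementary log-weights. -/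
noncomputable def colSum {n : ℕ} (W : Fin n → Fin n → ℝ) (j : Fin n) : ℝ :=
  ∑ i ∈ Finset.univ.filter (fun i => i ≠ j), Real.log (1 - W i j)

/-- `(a, b)` is a solution, in the parameter space `(0, ∞)ⁿ × (0, ∞)ⁿ`, of the system of maximum
likelihood equations for the edge-weight matrix `W`. -/
def SolvesMLEquations {n : ℕ} (W : Fin n → Fin n → ℝ) (a b : Fin n → ℝ) : Prop :=
  (∀ i, 0 < a i) ∧ (∀ j, 0 < b j) ∧
  (∀ i, (∑ j ∈ Finset.univ.filter (fun j => j ≠ i), realDigamma (a i + b j))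
      - ((n : ℝ) - 1) * realDigamma (a i) + rowSum W i = 0) ∧
  (∀ j, (∑ i ∈ Finset.univ.filter (fun i => i ≠ j), realDigamma (a i + b j))
      - ((n : ℝ) - 1) * realDigamma (b j) + colSum W j = 0)

/-!
The left-hand sides of the maximum likelihood equations form, up to sign, the gradient of
`negLogLik W θ = ∑_{i ≠ j} (log B(a i, b j) - a i log (W i j) - b j log (1 - W i j))`.
The beta function is strictly log-convex (`strictConvexOn_log_beta`, Hölder's inequality), so this
function is strictly convex on the open orthant: the solutions are its minimizers
(`solvesMLEquations_iff_isMinOn`), and there is at most one. It remains to see that a minimizer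
exists, that is, that sublevel sets are compact.

Near the boundary of the orthant the function blows up because `log B(a, b)` does
(`neg_log_le_log_beta`). At infinity, restricting the beta integral to an interval `(u, v)` gives the
affine minorant `a log u + b log (1 - v) + log (v - u)` of `log B(a, b)` (`le_log_beta_of_lt`). With
`u < v` suitably chosen for each pair, the resulting minorant of `negLogLik W` increases in a given
direction `(α, β)` unless `W i j = α i / (α i + β j)` for all `i ≠ j`, with denominators cleared
(`exists_pos_slope`); compactness of the unit sphere then bounds the sublevel sets. The exceptional
case means that the odds `W i j / (1 - W i j)` equal `α i / β j` off the diagonal, so that their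
products along the two orientations of any triangle agree. On three or more vertices this is an
equation that determines one weight by others independent of it, and the weights have no atoms, so
almost surely it does not occur (`ae_hasGenericTriangle`).
-/

/-! ### The beta function -/

theorem integrable_betaPDFReal {a b : ℝ} (ha : 0 < a) (hb : 0 < b) :
    Integrable (betaPDFReal a b) := by
  refine ⟨(measurable_betaPDFReal a b).aestronglyMeasurable, ?_⟩
  rw [hasFiniteIntegral_iff_ofReal]
  · have := lintegral_betaPDF_eq_one ha hb
    simp only [betaPDF] at this
    rw [this]
    exact ENNReal.one_lt_top
  · refine ae_of_all _ fun x => ?_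
    by_cases hx : 0 < x ∧ x < 1
    · exact (betaPDFReal_pos hx.1 hx.2 ha hb).le
    · simp [betaPDFReal, hx]

theorem integral_betaPDFReal {a b : ℝ} (ha : 0 < a) (hb : 0 < b) :
    ∫ x in Set.Ioo (0 : ℝ) 1, betaPDFReal a b x = 1 := by
  rw [setIntegral_eq_integral_of_forall_compl_eq_zero
    (fun x hx => by rw [betaPDFReal, if_neg (by simpa using hx)]),
    integral_eq_lintegral_of_nonneg_ae]
  · have := lintegral_betaPDF_eq_one ha hb
    simp only [betaPDF] at this
    rw [this, ENNReal.toReal_one]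
  · refine ae_of_all _ fun x => ?_
    by_cases hx : 0 < x ∧ x < 1
    · exact (betaPDFReal_pos hx.1 hx.2 ha hb).le
    · simp [betaPDFReal, hx]
  · exact (measurable_betaPDFReal a b).aestronglyMeasurable

theorem integrableOn_rpow_mul_rpow {a b : ℝ} (ha : 0 < a) (hb : 0 < b) :
    IntegrableOn (fun x : ℝ => x ^ (a - 1) * (1 - x) ^ (b - 1)) (Set.Ioo 0 1) := by
  have h : IntegrableOn (fun x => beta a b * betaPDFReal a b x) (Set.Ioo 0 1) :=
    (integrable_betaPDFReal ha hb).integrableOn.const_mul _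
  refine h.congr_fun (fun x hx => ?_) measurableSet_Ioo
  have := (beta_pos ha hb).ne'
  simp only [betaPDFReal, if_pos (show 0 < x ∧ x < 1 from hx)]
  field_simp

theorem integral_rpow_mul_rpow {a b : ℝ} (ha : 0 < a) (hb : 0 < b) :
    ∫ x in Set.Ioo (0 : ℝ) 1, x ^ (a - 1) * (1 - x) ^ (b - 1) = beta a b := by
  have h := integral_betaPDFReal ha hb
  have hB := (beta_pos ha hb).ne'
  have e : ∫ x in Set.Ioo (0 : ℝ) 1, betaPDFReal a b x =
      ∫ x in Set.Ioo (0 : ℝ) 1, (1 / beta a b) * (x ^ (a - 1) * (1 - x) ^ (b - 1)) :=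
    setIntegral_congr_fun measurableSet_Ioo fun x hx => by
      simp only [betaPDFReal, if_pos (show 0 < x ∧ x < 1 from hx), mul_assoc]
  rw [e, integral_const_mul] at h
  field_simp at h
  exact h

theorem setIntegral_rpow_mul_rpow_le_beta {a b : ℝ} (ha : 0 < a) (hb : 0 < b) {s : Set ℝ}
    (hs : s ⊆ Set.Ioo 0 1) :
    ∫ x in s, x ^ (a - 1) * (1 - x) ^ (b - 1) ≤ beta a b := by
  rw [← integral_rpow_mul_rpow ha hb]
  refine setIntegral_mono_set (integrableOn_rpow_mul_rpow ha hb) ?_ hs.eventuallyLE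
  refine ae_restrict_of_forall_mem measurableSet_Ioo fun x hx => ?_
  have h1 := hx.1
  have h2 := sub_pos.2 hx.2
  simp only [Pi.zero_apply]
  positivity

/-- Affine minorants of `log B`, from restricting the beta integral to `(u, v)`. -/
theorem le_log_beta_of_lt {a b u v : ℝ} (ha : 0 < a) (hb : 0 < b) (hu : 0 < u) (huv : u < v)
    (hv : v < 1) :
    a * Real.log u + b * Real.log (1 - v) + Real.log (v - u) ≤ Real.log (beta a b) := by
  have hv' : 0 < 1 - v := by linarith
  have hd : 0 < v - u := by linarith
  have hsub : Set.Ioo u v ⊆ Set.Ioo 0 1 := Set.Ioo_subset_Ioo hu.le hv.le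
  have key : (v - u) * (u ^ a * (1 - v) ^ b) ≤ beta a b := by
    refine le_trans ?_ (setIntegral_rpow_mul_rpow_le_beta ha hb hsub)
    have hc : ∫ _x in Set.Ioo u v, u ^ a * (1 - v) ^ b = (v - u) * (u ^ a * (1 - v) ^ b) := by
      simp [huv.le]
    rw [← hc]
    refine setIntegral_mono_on (integrableOn_const (by simp))
      ((integrableOn_rpow_mul_rpow ha hb).mono_set hsub)
      measurableSet_Ioo fun x hx => ?_
    have hx0 : 0 < x := hu.trans hx.1
    have hx1 : 0 < 1 - x := by linarith [hx.2]
    have e1 : u ^ a ≤ x ^ (a - 1) :=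
      (Real.rpow_le_rpow hu.le hx.1.le ha.le).trans
        (Real.rpow_le_rpow_of_exponent_ge hx0 (by linarith) (by linarith))
    have e2 : (1 - v) ^ b ≤ (1 - x) ^ (b - 1) :=
      (Real.rpow_le_rpow hv'.le (by linarith [hx.2]) hb.le).trans
        (Real.rpow_le_rpow_of_exponent_ge hx1 (by linarith) (by linarith))
    gcongr
  have := Real.log_le_log (by positivity) key
  rw [Real.log_mul (by positivity) (by positivity), Real.log_mul (by positivity) (by positivity),
    Real.log_rpow hu, Real.log_rpow hv'] at this
  linarith

theorem beta_comm (a b : ℝ) : beta a b = beta b a := by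
  simp only [beta, mul_comm, add_comm]

/-- `log B` blows up at the boundary `a = 0`, from restricting the beta integral to `(0, 1/2)`. -/
theorem neg_log_le_log_beta {a b : ℝ} (ha : 0 < a) (hb : 0 < b) :
    -Real.log a - (a + b) * Real.log 2 ≤ Real.log (beta a b) := by
  have hsub : Set.Ioo (0 : ℝ) (1 / 2) ⊆ Set.Ioo 0 1 := Set.Ioo_subset_Ioo le_rfl (by norm_num)
  have hint : IntegrableOn (fun x : ℝ => x ^ (a - 1)) (Set.Ioo 0 (1 / 2)) := by
    rw [← intervalIntegrable_iff_integrableOn_Ioo_of_le (by norm_num)]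
    exact intervalIntegral.intervalIntegrable_rpow' (by linarith)
  have key : (1 / 2 : ℝ) ^ a / a * (1 / 2 : ℝ) ^ b ≤ beta a b := by
    refine le_trans ?_ (setIntegral_rpow_mul_rpow_le_beta ha hb hsub)
    have hc : ∫ x in Set.Ioo (0 : ℝ) (1 / 2), x ^ (a - 1) * (1 / 2 : ℝ) ^ b =
        (1 / 2 : ℝ) ^ a / a * (1 / 2 : ℝ) ^ b := by
      rw [integral_mul_const, ← integral_Ioc_eq_integral_Ioo,
        ← intervalIntegral.integral_of_le (by norm_num), integral_rpow (Or.inl (by linarith))]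
      simp [Real.zero_rpow ha.ne']
    rw [← hc]
    refine setIntegral_mono_on (hint.mul_const _)
      ((integrableOn_rpow_mul_rpow ha hb).mono_set hsub) measurableSet_Ioo fun x hx => ?_
    have hx0 : 0 < x := hx.1
    have hx1 : 1 / 2 < 1 - x := by linarith [hx.2]
    have e2 : (1 / 2 : ℝ) ^ b ≤ (1 - x) ^ (b - 1) :=
      (Real.rpow_le_rpow (by norm_num) hx1.le hb.le).trans
        (Real.rpow_le_rpow_of_exponent_ge (by linarith) (by linarith) (by linarith))
    gcongr
  have := Real.log_le_log (by positivity) key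
  rw [Real.log_mul (by positivity) (by positivity), Real.log_div (by positivity) (by positivity),
    Real.log_rpow (by norm_num), Real.log_rpow (by norm_num), one_div, Real.log_inv] at this
  linarith

/-- The sufficient statistics `log x`, `log (1 - x)` of the beta family are affinely independent;
the points `1/4`, `1/2`, `3/4` suffice to see it. -/
theorem eq_zero_of_mul_log_add_mul_log_one_sub {c d e : ℝ}
    (h : ∀ x ∈ Set.Ioo (0 : ℝ) 1, c * Real.log x + d * Real.log (1 - x) = e) :
    c = 0 ∧ d = 0 := by
  have h1 := h (1 / 4) ⟨by norm_num, by norm_num⟩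
  have h2 := h (3 / 4) ⟨by norm_num, by norm_num⟩
  have h3 := h (1 / 2) ⟨by norm_num, by norm_num⟩
  have l4 : Real.log 4 = 2 * Real.log 2 := by
    rw [show (4 : ℝ) = 2 ^ 2 by norm_num, Real.log_pow]; norm_num
  have l34 : Real.log 3 < Real.log 4 := Real.log_lt_log (by norm_num) (by norm_num)
  have l3 : 0 < Real.log 3 := Real.log_pos (by norm_num)
  have a1 : Real.log (1 / 4) = -(2 * Real.log 2) := by rw [one_div, Real.log_inv, l4]
  have a2 : Real.log (3 / 4) = Real.log 3 - 2 * Real.log 2 := by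
    rw [Real.log_div (by norm_num) (by norm_num), l4]
  have a3 : Real.log (1 / 2) = -Real.log 2 := by rw [one_div, Real.log_inv]
  rw [show (1 - 1 / 4 : ℝ) = 3 / 4 by norm_num, a1, a2] at h1
  rw [show (1 - 3 / 4 : ℝ) = 1 / 4 by norm_num, a1, a2] at h2
  rw [show (1 - 1 / 2 : ℝ) = 1 / 2 by norm_num, a3] at h3
  have hcd : (d - c) * Real.log 3 = 0 := by linarith
  have hcd' : d = c := by
    rcases mul_eq_zero.1 hcd with h | h
    · linarith
    · exact absurd h l3.ne'
  subst hcd'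
  have : d * (Real.log 3 - Real.log 4) = 0 := by rw [l4]; linarith
  rcases mul_eq_zero.1 this with h | h
  · exact ⟨h, h⟩
  · linarith

/-- Strict log-convexity of the beta function: Hölder's inequality for the beta integral, which is
strict because distinct beta densities differ somewhere on `(0, 1)`. -/
theorem strictConvexOn_log_beta :
    StrictConvexOn ℝ (Set.Ioi (0 : ℝ) ×ˢ Set.Ioi (0 : ℝ))
      (fun p : ℝ × ℝ => Real.log (beta p.1 p.2)) := by
  refine ⟨(convex_Ioi 0).prod (convex_Ioi 0), ?_⟩
  rintro ⟨a, b⟩ ⟨ha, hb⟩ ⟨a', b'⟩ ⟨ha', hb'⟩ hne s t hs ht hst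
  simp only [Set.mem_Ioi] at ha hb ha' hb'
  simp only [Prod.smul_mk, Prod.mk_add_mk, smul_eq_mul]
  have hB := beta_pos ha hb
  have hB' := beta_pos ha' hb'
  have hm1 : 0 < s * a + t * a' := by positivity
  have hm2 : 0 < s * b + t * b' := by positivity
  have hM := beta_pos hm1 hm2
  set p : ℝ → ℝ := fun x => (1 / beta a b) * (x ^ (a - 1) * (1 - x) ^ (b - 1)) with hp
  set q : ℝ → ℝ := fun x => (1 / beta a' b') * (x ^ (a' - 1) * (1 - x) ^ (b' - 1)) with hq
  set c : ℝ := (1 / beta a b) ^ s * (1 / beta a' b') ^ t with hc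
  have hcpos : 0 < c := by positivity
  set m : ℝ → ℝ := fun x =>
    c * (x ^ (s * a + t * a' - 1) * (1 - x) ^ (s * b + t * b' - 1)) with hmdef
  have hp0 : ∀ x ∈ Set.Ioo (0 : ℝ) 1, 0 < p x := fun x hx => by
    have h1 := hx.1
    have h2 := sub_pos.2 hx.2
    simp only [hp]; positivity
  have hq0 : ∀ x ∈ Set.Ioo (0 : ℝ) 1, 0 < q x := fun x hx => by
    have h1 := hx.1
    have h2 := sub_pos.2 hx.2
    simp only [hq]; positivity
  have hgeom : ∀ x ∈ Set.Ioo (0 : ℝ) 1, m x = p x ^ s * q x ^ t := fun x hx => by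
    have h1 := hx.1
    have h2 := sub_pos.2 hx.2
    simp only [hp, hq, hmdef, hc]
    rw [Real.mul_rpow (by positivity) (by positivity), Real.mul_rpow (by positivity) (by positivity),
      Real.mul_rpow (by positivity) (by positivity), Real.mul_rpow (by positivity) (by positivity),
      ← Real.rpow_mul h1.le, ← Real.rpow_mul h1.le, ← Real.rpow_mul h2.le, ← Real.rpow_mul h2.le,
      show s * a + t * a' - 1 = (a - 1) * s + (a' - 1) * t by linear_combination hst,
      show s * b + t * b' - 1 = (b - 1) * s + (b' - 1) * t by linear_combination hst,
      Real.rpow_add h1, Real.rpow_add h2]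
    ring
  have hex : ∃ x ∈ Set.Ioo (0 : ℝ) 1, p x - q x ≠ 0 := by
    by_contra! hcon
    have hlog : ∀ x ∈ Set.Ioo (0 : ℝ) 1, (a - a') * Real.log x + (b - b') * Real.log (1 - x) =
        Real.log (1 / beta a' b') - Real.log (1 / beta a b) := fun x hx => by
      have h1 := hx.1
      have h2 := sub_pos.2 hx.2
      have := congrArg Real.log (sub_eq_zero.1 (hcon x hx))
      simp only [hp, hq] at this
      rw [Real.log_mul (by positivity) (by positivity), Real.log_mul (by positivity) (by positivity),
        Real.log_mul (by positivity) (by positivity), Real.log_mul (by positivity) (by positivity),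
        Real.log_rpow h1, Real.log_rpow h1, Real.log_rpow h2, Real.log_rpow h2] at this
      linarith
    obtain ⟨e1, e2⟩ := eq_zero_of_mul_log_add_mul_log_one_sub hlog
    exact hne (by rw [sub_eq_zero.1 e1, sub_eq_zero.1 e2])
  have ip : IntegrableOn p (Set.Ioo 0 1) := (integrableOn_rpow_mul_rpow ha hb).const_mul _
  have iq : IntegrableOn q (Set.Ioo 0 1) := (integrableOn_rpow_mul_rpow ha' hb').const_mul _
  have im : IntegrableOn m (Set.Ioo 0 1) := (integrableOn_rpow_mul_rpow hm1 hm2).const_mul _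
  have Ip : ∫ x in Set.Ioo (0 : ℝ) 1, p x = 1 := by
    simp only [hp]; rw [integral_const_mul, integral_rpow_mul_rpow ha hb]; field_simp
  have Iq : ∫ x in Set.Ioo (0 : ℝ) 1, q x = 1 := by
    simp only [hq]; rw [integral_const_mul, integral_rpow_mul_rpow ha' hb']; field_simp
  have Im : ∫ x in Set.Ioo (0 : ℝ) 1, m x = c * beta (s * a + t * a') (s * b + t * b') := by
    simp only [hmdef]; rw [integral_const_mul, integral_rpow_mul_rpow hm1 hm2]
  have hcont : ContinuousOn (fun x => p x - q x) (Set.Ioo 0 1) := by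
    intro x hx
    have h1 : x ≠ 0 := hx.1.ne'
    have h2 : 1 - x ≠ 0 := (sub_pos.2 hx.2).ne'
    have e1 : ∀ r : ℝ, ContinuousAt (fun y : ℝ => y ^ r) x := fun r =>
      Real.continuousAt_rpow_const x r (Or.inl h1)
    have e2 : ∀ r : ℝ, ContinuousAt (fun y : ℝ => (1 - y) ^ r) x := fun r =>
      (continuousAt_const.sub continuousAt_id).rpow_const (Or.inl h2)
    exact ((continuousAt_const.mul ((e1 _).mul (e2 _))).sub
      (continuousAt_const.mul ((e1 _).mul (e2 _)))).continuousWithinAt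
  have hpos : 0 < ∫ x in Set.Ioo (0 : ℝ) 1, (s * p x + t * q x - m x) := by
    rw [setIntegral_pos_iff_support_of_nonneg_ae]
    · have hopen : IsOpen (Set.Ioo (0 : ℝ) 1 ∩ (fun x => p x - q x) ⁻¹' {0}ᶜ) :=
        hcont.isOpen_inter_preimage isOpen_Ioo isOpen_compl_singleton
      obtain ⟨x, hx, hxn⟩ := hex
      refine (hopen.measure_pos volume ⟨x, hx, hxn⟩).trans_le (measure_mono ?_)
      rintro y ⟨hy, hyn⟩
      refine ⟨?_, hy⟩
      have := (Real.geom_mean_lt_arith_mean2_weighted_iff_of_pos hs ht (hp0 y hy).le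
        (hq0 y hy).le hst).2 (sub_ne_zero.1 hyn)
      rw [Function.mem_support, hgeom y hy]
      exact (sub_pos.2 this).ne'
    · refine ae_restrict_of_forall_mem measurableSet_Ioo fun y hy => ?_
      have := Real.geom_mean_le_arith_mean2_weighted hs.le ht.le (hp0 y hy).le (hq0 y hy).le hst
      rw [← hgeom y hy] at this
      exact sub_nonneg.2 this
    · exact ((ip.const_mul s).add (iq.const_mul t)).sub im
  have hpq : IntegrableOn (fun x => s * p x + t * q x) (Set.Ioo 0 1) :=
    (ip.const_mul s).add (iq.const_mul t)
  clear_value p q m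
  rw [integral_sub hpq im, integral_add (ip.const_mul s) (iq.const_mul t), integral_const_mul,
    integral_const_mul, Ip, Iq, Im] at hpos
  have hlt : c * beta (s * a + t * a') (s * b + t * b') < 1 := by linarith
  have := Real.log_neg (by positivity) hlt
  rw [Real.log_mul hcpos.ne' hM.ne', hc, Real.log_mul (by positivity) (by positivity),
    Real.log_rpow (by positivity), Real.log_rpow (by positivity), one_div, one_div,
    Real.log_inv, Real.log_inv] at this
  linarith

/-! ### The negative log-likelihood and its critical points -/

/-- The parameter space `(0, ∞)ⁿ × (0, ∞)ⁿ`. -/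
def parameterSpace (n : ℕ) : Set ((Fin n → ℝ) × (Fin n → ℝ)) :=
  {θ | (∀ i, 0 < θ.1 i) ∧ ∀ j, 0 < θ.2 j}

/-- Negative log-likelihood of the beta parameters `p` at one observation `x`, up to the term
`log x + log (1 - x)`, which does not depend on `p`. -/
noncomputable def edgeLoss (x : ℝ) (p : ℝ × ℝ) : ℝ :=
  Real.log (beta p.1 p.2) - p.1 * Real.log x - p.2 * Real.log (1 - x)

/-- Negative log-likelihood of the edge-weight matrix `W`, up to a term not depending on the
parameters; the sum is over the ordered pairs `(i, j)` with `i ≠ j`. -/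
noncomputable def negLogLik {n : ℕ} (W : Fin n → Fin n → ℝ) (θ : (Fin n → ℝ) × (Fin n → ℝ)) : ℝ :=
  ∑ p ∈ (Finset.univ : Finset (Fin n)).offDiag, edgeLoss (W p.1 p.2) (θ.1 p.1, θ.2 p.2)

theorem isOpen_parameterSpace (n : ℕ) : IsOpen (parameterSpace n) := by
  simp only [parameterSpace, Set.ofPred_and, Set.ofPred_forall]
  exact (isOpen_iInter_of_finite fun i => isOpen_lt continuous_const (by fun_prop)).inter
    (isOpen_iInter_of_finite fun i => isOpen_lt continuous_const (by fun_prop))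

theorem convex_parameterSpace (n : ℕ) : Convex ℝ (parameterSpace n) := by
  intro θ hθ η hη s t hs ht hst
  have h : ∀ x y : ℝ, 0 < x → 0 < y → 0 < s * x + t * y := fun x y hx hy =>
    (convex_Ioi (0 : ℝ)) hx hy hs ht hst
  exact ⟨fun i => h _ _ (hθ.1 i) (hη.1 i), fun j => h _ _ (hθ.2 j) (hη.2 j)⟩

theorem sum_offDiag_left {n : ℕ} (f : Fin n × Fin n → ℝ) :
    ∑ p ∈ (Finset.univ : Finset (Fin n)).offDiag, f p =
      ∑ i, ∑ j ∈ Finset.univ.filter (fun j => j ≠ i), f (i, j) :=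
  Finset.sum_finset_product _ _ _ fun p => by simp [eq_comm]

theorem sum_offDiag_right {n : ℕ} (f : Fin n × Fin n → ℝ) :
    ∑ p ∈ (Finset.univ : Finset (Fin n)).offDiag, f p =
      ∑ j, ∑ i ∈ Finset.univ.filter (fun i => i ≠ j), f (i, j) :=
  Finset.sum_finset_product_right _ _ _ fun p => by simp

theorem sum_filter_ne_const {n : ℕ} (i : Fin n) (c : ℝ) :
    ∑ _j ∈ Finset.univ.filter (fun j => j ≠ i), c = ((n : ℝ) - 1) * c := by
  have : 1 ≤ n := i.pos
  rw [Finset.sum_const, Finset.filter_ne', Finset.card_erase_of_mem (Finset.mem_univ i),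
    Finset.card_univ, Fintype.card_fin, nsmul_eq_mul, Nat.cast_sub this, Nat.cast_one]

theorem hasDerivAt_log_Gamma {x : ℝ} (hx : 0 < x) :
    HasDerivAt (fun y => Real.log (Real.Gamma y)) (realDigamma x) x :=
  (Real.differentiableAt_Gamma fun m => by
    have : (0 : ℝ) ≤ m := m.cast_nonneg
    linarith).hasDerivAt.log (Real.Gamma_pos_of_pos hx).ne'

theorem log_beta {a b : ℝ} (ha : 0 < a) (hb : 0 < b) : Real.log (beta a b) =
    Real.log (Real.Gamma a) + Real.log (Real.Gamma b) - Real.log (Real.Gamma (a + b)) := by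
  have h1 := Real.Gamma_pos_of_pos ha
  have h2 := Real.Gamma_pos_of_pos hb
  have h3 := Real.Gamma_pos_of_pos (add_pos ha hb)
  rw [beta, Real.log_div (by positivity) h3.ne', Real.log_mul h1.ne' h2.ne']

theorem hasDerivAt_edgeLoss_line (x : ℝ) {a b : ℝ} (ha : 0 < a) (hb : 0 < b) (c d : ℝ) :
    HasDerivAt (fun t : ℝ => edgeLoss x (a + t * c, b + t * d))
      (c * (realDigamma a - realDigamma (a + b) - Real.log x) +
        d * (realDigamma b - realDigamma (a + b) - Real.log (1 - x))) 0 := by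
  have hA : HasDerivAt (fun t : ℝ => a + t * c) c 0 := by
    simpa using ((hasDerivAt_id (0 : ℝ)).mul_const c).const_add a
  have hB : HasDerivAt (fun t : ℝ => b + t * d) d 0 := by
    simpa using ((hasDerivAt_id (0 : ℝ)).mul_const d).const_add b
  have ea : ∀ᶠ t in nhds (0 : ℝ), 0 < a + t * c :=
    hA.continuousAt.eventually_const_lt (by simpa using ha)
  have eb : ∀ᶠ t in nhds (0 : ℝ), 0 < b + t * d :=
    hB.continuousAt.eventually_const_lt (by simpa using hb)
  have gA : HasDerivAt (fun t : ℝ => Real.log (Real.Gamma (a + t * c))) (realDigamma a * c) 0 :=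
    HasDerivAt.comp (0 : ℝ) (h₂ := fun y => Real.log (Real.Gamma y))
      (by simpa using hasDerivAt_log_Gamma ha) hA
  have gB : HasDerivAt (fun t : ℝ => Real.log (Real.Gamma (b + t * d))) (realDigamma b * d) 0 :=
    HasDerivAt.comp (0 : ℝ) (h₂ := fun y => Real.log (Real.Gamma y))
      (by simpa using hasDerivAt_log_Gamma hb) hB
  have gAB : HasDerivAt (fun t : ℝ => Real.log (Real.Gamma ((a + t * c) + (b + t * d))))
      (realDigamma (a + b) * (c + d)) 0 :=
    HasDerivAt.comp (0 : ℝ) (h₂ := fun y => Real.log (Real.Gamma y))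
      (by simpa using hasDerivAt_log_Gamma (add_pos ha hb)) (hA.add hB)
  have main := (((gA.add gB).sub gAB).sub (hA.mul_const (Real.log x))).sub
    (hB.mul_const (Real.log (1 - x)))
  refine (main.congr_of_eventuallyEq ?_).congr_deriv (by ring)
  filter_upwards [ea, eb] with t h1 h2
  simp only [edgeLoss, Pi.add_apply, Pi.sub_apply, log_beta h1 h2]

/-- The derivative of the negative log-likelihood in direction `d` is minus the pairing of `d` with
the left-hand sides of the maximum likelihood equations. -/
theorem hasDerivAt_negLogLik_line {n : ℕ} (W : Fin n → Fin n → ℝ)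
    {θ : (Fin n → ℝ) × (Fin n → ℝ)} (hθ : θ ∈ parameterSpace n) (d : (Fin n → ℝ) × (Fin n → ℝ)) :
    HasDerivAt (fun t : ℝ => negLogLik W (θ + t • d))
      (-(∑ i, d.1 i * ((∑ j ∈ Finset.univ.filter (fun j => j ≠ i), realDigamma (θ.1 i + θ.2 j))
            - ((n : ℝ) - 1) * realDigamma (θ.1 i) + rowSum W i) +
          ∑ j, d.2 j * ((∑ i ∈ Finset.univ.filter (fun i => i ≠ j), realDigamma (θ.1 i + θ.2 j))
            - ((n : ℝ) - 1) * realDigamma (θ.2 j) + colSum W j))) 0 := by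
  have h := HasDerivAt.fun_sum (u := (Finset.univ : Finset (Fin n)).offDiag) (x := (0 : ℝ))
    fun p _ => hasDerivAt_edgeLoss_line (W p.1 p.2) (hθ.1 p.1) (hθ.2 p.2) (d.1 p.1) (d.2 p.2)
  refine h.congr_deriv ?_
  rw [Finset.sum_add_distrib, sum_offDiag_left, sum_offDiag_right, neg_add,
    ← Finset.sum_neg_distrib, ← Finset.sum_neg_distrib]
  congr 1
  · refine Finset.sum_congr rfl fun i _ => ?_
    dsimp only
    rw [← Finset.mul_sum, Finset.sum_sub_distrib, Finset.sum_sub_distrib, sum_filter_ne_const,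
      rowSum]
    ring
  · refine Finset.sum_congr rfl fun j _ => ?_
    dsimp only
    rw [← Finset.mul_sum, Finset.sum_sub_distrib, Finset.sum_sub_distrib, sum_filter_ne_const,
      colSum]
    ring

theorem strictConvexOn_edgeLoss (x : ℝ) :
    StrictConvexOn ℝ (Set.Ioi (0 : ℝ) ×ˢ Set.Ioi (0 : ℝ)) (edgeLoss x) := by
  refine ⟨strictConvexOn_log_beta.1, fun p hp q hq hne s t hs ht hst => ?_⟩
  have := strictConvexOn_log_beta.2 hp hq hne hs ht hst
  simp only [edgeLoss, Prod.fst_add, Prod.snd_add, Prod.smul_fst, Prod.smul_snd,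
    smul_eq_mul] at this ⊢
  linarith

theorem strictConvexOn_negLogLik {n : ℕ} (hn : 2 ≤ n) (W : Fin n → Fin n → ℝ) :
    StrictConvexOn ℝ (parameterSpace n) (negLogLik W) := by
  refine ⟨convex_parameterSpace n, fun θ hθ η hη hne s t hs ht hst => ?_⟩
  have : Nontrivial (Fin n) := Fin.nontrivial_iff_two_le.2 hn
  simp only [negLogLik, smul_eq_mul, Finset.mul_sum]
  rw [← Finset.sum_add_distrib]
  have hle : ∀ p : Fin n × Fin n, edgeLoss (W p.1 p.2) ((s • θ + t • η).1 p.1,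
      (s • θ + t • η).2 p.2) ≤ s * edgeLoss (W p.1 p.2) (θ.1 p.1, θ.2 p.2) +
        t * edgeLoss (W p.1 p.2) (η.1 p.1, η.2 p.2) := fun p =>
    (strictConvexOn_edgeLoss (W p.1 p.2)).convexOn.2 (x := (θ.1 p.1, θ.2 p.2))
      (y := (η.1 p.1, η.2 p.2)) ⟨hθ.1 _, hθ.2 _⟩ ⟨hη.1 _, hη.2 _⟩ hs.le ht.le hst
  refine Finset.sum_lt_sum (fun p _ => hle p) ?_
  -- distinct parameters are told apart by some off-diagonal pair
  obtain ⟨p, hp, hpne⟩ : ∃ p ∈ (Finset.univ : Finset (Fin n)).offDiag,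
      (θ.1 p.1, θ.2 p.2) ≠ (η.1 p.1, η.2 p.2) := by
    by_contra! hcon
    refine hne (Prod.ext (funext fun i => ?_) (funext fun j => ?_))
    · obtain ⟨j, hj⟩ := exists_ne i
      exact congrArg Prod.fst (hcon (i, j) (by simp [hj.symm]))
    · obtain ⟨i, hi⟩ := exists_ne j
      exact congrArg Prod.snd (hcon (i, j) (by simp [hi]))
  exact ⟨p, hp, (strictConvexOn_edgeLoss (W p.1 p.2)).2 (x := (θ.1 p.1, θ.2 p.2))
      (y := (η.1 p.1, η.2 p.2)) ⟨hθ.1 _, hθ.2 _⟩ ⟨hη.1 _, hη.2 _⟩ hpne hs ht hst⟩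

/-- By convexity, the maximum likelihood equations characterize the minimizers of the negative
log-likelihood. -/
theorem solvesMLEquations_iff_isMinOn {n : ℕ} (hn : 2 ≤ n) (W : Fin n → Fin n → ℝ)
    {θ : (Fin n → ℝ) × (Fin n → ℝ)} (hθ : θ ∈ parameterSpace n) :
    SolvesMLEquations W θ.1 θ.2 ↔ IsMinOn (negLogLik W) (parameterSpace n) θ := by
  constructor
  · rintro ⟨-, -, h1, h2⟩ η hη
    have hd := hasDerivAt_negLogLik_line W hθ (η - θ)
    simp only [h1, h2, mul_zero, Finset.sum_const_zero, add_zero, neg_zero] at hd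
    have hconv : ConvexOn ℝ (Set.Icc (0 : ℝ) 1) (fun t : ℝ => negLogLik W (θ + t • (η - θ))) := by
      have := (strictConvexOn_negLogLik hn W).convexOn.comp_affineMap (AffineMap.lineMap θ η)
      refine (this.subset (fun t ht => ?_) (convex_Icc 0 1)).congr fun t _ => ?_
      · exact (convex_parameterSpace n).lineMap_mem hθ hη ht
      · simp [AffineMap.lineMap_apply, add_comm]
    have := hconv.le_slope_of_hasDerivAt (by simp) (by simp) zero_lt_one hd
    simp only [slope_def_field, one_smul, zero_smul, add_zero, add_sub_cancel, sub_zero,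
      div_one] at this
    exact sub_nonneg.1 this
  · intro hmin
    have hloc : ∀ d : (Fin n → ℝ) × (Fin n → ℝ),
        IsLocalMin (fun t : ℝ => negLogLik W (θ + t • d)) 0 := fun d => by
      have hc : ContinuousAt (fun t : ℝ => θ + t • d) 0 := by fun_prop
      have hmem : ∀ᶠ t in nhds (0 : ℝ), θ + t • d ∈ parameterSpace n :=
        hc.eventually_mem ((isOpen_parameterSpace n).mem_nhds (by simpa using hθ))
      filter_upwards [hmem] with t ht
      simpa using hmin ht
    have hzero := fun d => (hloc d).hasDerivAt_eq_zero (hasDerivAt_negLogLik_line W hθ d)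
    refine ⟨hθ.1, hθ.2, fun i => ?_, fun j => ?_⟩
    · have := neg_eq_zero.1 (hzero (Pi.single i 1, 0))
      simpa [Pi.single_apply] using this
    · have := neg_eq_zero.1 (hzero (0, Pi.single j 1))
      simpa [Pi.single_apply] using this

/-! ### Coercivity of the negative log-likelihood -/

/-- The odds `w i j / (1 - w i j)` are not of the form `α i / β j` on the off-diagonal pairs, as
witnessed by the two orientations of some triangle; denominators are cleared. -/
def HasGenericTriangle {n : ℕ} (W : Fin n → Fin n → ℝ) : Prop :=
  ∃ i j k, i ≠ j ∧ j ≠ k ∧ k ≠ i ∧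
    W i j * W j k * W k i * ((1 - W i k) * (1 - W k j) * (1 - W j i)) ≠
      W i k * W k j * W j i * ((1 - W i j) * (1 - W j k) * (1 - W k i))

/-- If `W i j = α i / (α i + β j)` off the diagonal, then multiplying the equations along a triangle
in both orientations gives the same product of the `α`s and `β`s, against `HasGenericTriangle`
unless a coordinate vanishes; a vanishing coordinate then forces all others to vanish. -/
theorem eq_zero_of_hasGenericTriangle {n : ℕ} {W : Fin n → Fin n → ℝ}
    (hW : ∀ i j, i ≠ j → W i j ∈ Set.Ioo (0 : ℝ) 1) (hgen : HasGenericTriangle W)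
    {d : (Fin n → ℝ) × (Fin n → ℝ)}
    (h : ∀ i j, i ≠ j → d.1 i * (1 - W i j) = d.2 j * W i j) : d = 0 := by
  obtain ⟨i, j, k, hij, hjk, hki, hne⟩ := hgen
  have third : ∀ x y : Fin n, ∃ z, z ≠ x ∧ z ≠ y := fun x y => by
    by_cases h1 : i ≠ x ∧ i ≠ y
    · exact ⟨i, h1⟩
    by_cases h2 : j ≠ x ∧ j ≠ y
    · exact ⟨j, h2⟩
    · exact ⟨k, by grind, by grind⟩
  have hprod : d.1 i * d.1 j * d.1 k = 0 := by
    have e1 := congrArg₂ (· * ·) (congrArg₂ (· * ·) (h i j hij) (h j k hjk)) (h k i hki)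
    have e2 := congrArg₂ (· * ·) (congrArg₂ (· * ·) (h i k hki.symm) (h k j hjk.symm))
      (h j i hij.symm)
    refine (mul_eq_zero.1 (?_ : (d.1 i * d.1 j * d.1 k) *
      (W i j * W j k * W k i * ((1 - W i k) * (1 - W k j) * (1 - W j i)) -
        W i k * W k j * W j i * ((1 - W i j) * (1 - W j k) * (1 - W k i))) = 0)).resolve_right
      (sub_ne_zero.2 hne)
    linear_combination (W i j * W j k * W k i) * e2 - (W i k * W k j * W j i) * e1
  obtain ⟨m, hm⟩ : ∃ m, d.1 m = 0 := by
    rcases mul_eq_zero.1 hprod with h' | h'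
    · rcases mul_eq_zero.1 h' with h'' | h''
      exacts [⟨i, h''⟩, ⟨j, h''⟩]
    · exact ⟨k, h'⟩
  have toβ : ∀ x y, x ≠ y → d.1 x = 0 → d.2 y = 0 := fun x y hxy hx => by
    have := h x y hxy
    rw [hx, zero_mul, eq_comm, mul_eq_zero] at this
    exact this.resolve_right (hW x y hxy).1.ne'
  have toα : ∀ x y, x ≠ y → d.2 y = 0 → d.1 x = 0 := fun x y hxy hy => by
    have := h x y hxy
    rw [hy, zero_mul, mul_eq_zero] at this
    exact this.resolve_right (sub_pos.2 (hW x y hxy).2).ne'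
  have hα : ∀ x, d.1 x = 0 := fun x => by
    obtain ⟨z, hzx, hzm⟩ := third x m
    exact toα x z hzx.symm (toβ m z hzm.symm hm)
  have hβ : ∀ y, d.2 y = 0 := fun y => by
    obtain ⟨z, hzy, -⟩ := third y y
    exact toβ z y hzy (hα z)
  exact Prod.ext (funext hα) (funext hβ)

/-- The asymptotic slope at which `edgeLoss w` grows in direction `(α, β)` is the supremum over `x`
of `α log (x / w) + β log ((1 - x) / (1 - w))`; it can vanish only if
`α (1 - w) = β w`. -/
theorem exists_pos_edge_slope {w α β : ℝ} (hw : w ∈ Set.Ioo (0 : ℝ) 1)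
    (h : α * (1 - w) ≠ β * w) : ∃ x ∈ Set.Ioo (0 : ℝ) 1,
      0 < α * (Real.log x - Real.log w) + β * (Real.log (1 - x) - Real.log (1 - w)) := by
  by_contra! hcon
  have h0 : w ≠ 0 := hw.1.ne'
  have h1 : 1 - w ≠ 0 := (sub_pos.2 hw.2).ne'
  have hd : HasDerivAt (fun x => α * (Real.log x - Real.log w) +
      β * (Real.log (1 - x) - Real.log (1 - w))) (α * w⁻¹ + β * (-1 / (1 - w))) w :=
    (((Real.hasDerivAt_log h0).sub_const _).const_mul α).add
      (((((hasDerivAt_id w).const_sub 1).log h1).sub_const _).const_mul β)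
  have hmax : IsLocalMax (fun x => α * (Real.log x - Real.log w) +
      β * (Real.log (1 - x) - Real.log (1 - w))) w := by
    filter_upwards [Ioo_mem_nhds hw.1 hw.2] with x hx
    simpa using hcon x hx
  have := hmax.hasDerivAt_eq_zero hd
  field_simp at this
  exact h (by linarith)

/-- In each direction `d ≠ 0` some affine minorant of the negative log-likelihood increases.
Restricting the beta integral of the pair `p` to `(x p, x p + δ)` supplies it;
`δ` has to be small enough not to destroy positivity. -/
theorem exists_pos_slope {n : ℕ} {W : Fin n → Fin n → ℝ}
    (hW : ∀ i j, i ≠ j → W i j ∈ Set.Ioo (0 : ℝ) 1) (hgen : HasGenericTriangle W)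
    {d : (Fin n → ℝ) × (Fin n → ℝ)} (hd : d ≠ 0) :
    ∃ u v : Fin n × Fin n → ℝ,
      (∀ p ∈ (Finset.univ : Finset (Fin n)).offDiag, 0 < u p ∧ u p < v p ∧ v p < 1) ∧
      0 < ∑ p ∈ (Finset.univ : Finset (Fin n)).offDiag,
        (d.1 p.1 * (Real.log (u p) - Real.log (W p.1 p.2)) +
          d.2 p.2 * (Real.log (1 - v p) - Real.log (1 - W p.1 p.2))) := by
  obtain ⟨i, j, hij, hne⟩ : ∃ i j, i ≠ j ∧ d.1 i * (1 - W i j) ≠ d.2 j * W i j := by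
    by_contra! hcon
    exact hd (eq_zero_of_hasGenericTriangle hW hgen hcon)
  obtain ⟨x₀, hx₀, hpos⟩ := exists_pos_edge_slope (hW i j hij) hne
  set x : Fin n × Fin n → ℝ := fun p => if p = (i, j) then x₀ else W p.1 p.2 with hx
  have hxmem : ∀ p ∈ (Finset.univ : Finset (Fin n)).offDiag, x p ∈ Set.Ioo (0 : ℝ) 1 :=
    fun p hp => by
      simp only [hx]
      split_ifs
      · exact hx₀
      · exact hW _ _ (Finset.mem_offDiag.1 hp).2.2
  set S : ℝ → ℝ := fun δ => ∑ p ∈ (Finset.univ : Finset (Fin n)).offDiag,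
    (d.1 p.1 * (Real.log (x p) - Real.log (W p.1 p.2)) +
      d.2 p.2 * (Real.log (1 - (x p + δ)) - Real.log (1 - W p.1 p.2))) with hS
  have hS0 : 0 < S 0 := by
    refine Finset.sum_pos' (fun p hp => ?_) ⟨(i, j), by simp [hij], by simpa [hx] using hpos⟩
    simp only [hx, add_zero]
    split_ifs with hpe
    · subst hpe; exact hpos.le
    · simp
  have hcont : ContinuousAt S 0 := by
    refine tendsto_finsetSum _ fun p hp => ?_
    have h1 : 1 - (x p + 0) ≠ 0 := by linarith [(hxmem p hp).2]
    exact (continuousAt_const.add (continuousAt_const.mul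
      (((continuousAt_const.sub (continuousAt_const.add continuousAt_id)).log h1).sub
        continuousAt_const)))
  have hlt : ∀ᶠ δ in nhds (0 : ℝ), ∀ p ∈ (Finset.univ : Finset (Fin n)).offDiag, x p + δ < 1 := by
    rw [Filter.eventually_all_finset]
    intro p hp
    have : ContinuousAt (fun δ : ℝ => x p + δ) 0 := by fun_prop
    exact this.eventually_lt_const (by simpa using (hxmem p hp).2)
  have hev := ((hcont.eventually_const_lt hS0).and hlt).filter_mono
    (nhdsWithin_le_nhds (s := Set.Ioi (0 : ℝ)))
  obtain ⟨δ, ⟨hδS, hδlt⟩, hδ⟩ := (hev.and self_mem_nhdsWithin).exists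
  exact ⟨x, fun p => x p + δ, fun p hp => ⟨(hxmem p hp).1, by simpa using hδ, hδlt p hp⟩, hδS⟩

/-- A sequence of parameters in a sublevel set with norms tending to infinity would have a limiting
direction, along which an affine minorant increases without bound. -/
theorem exists_norm_le_of_negLogLik_le {n : ℕ} {W : Fin n → Fin n → ℝ}
    (hW : ∀ i j, i ≠ j → W i j ∈ Set.Ioo (0 : ℝ) 1) (hgen : HasGenericTriangle W) (c : ℝ) :
    ∃ M : ℝ, ∀ θ ∈ parameterSpace n, negLogLik W θ ≤ c → ‖θ‖ ≤ M := by
  by_contra! hcon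
  choose θ hθ hθc hθn using fun k : ℕ => hcon ((k : ℝ) + 1)
  have hnpos : ∀ k, 0 < ‖θ k‖ := fun k => by
    have : (0 : ℝ) ≤ k := k.cast_nonneg
    linarith [hθn k]
  have hsph : ∀ k, ‖θ k‖⁻¹ • θ k ∈ Metric.sphere (0 : (Fin n → ℝ) × (Fin n → ℝ)) 1 := fun k => by
    simp [norm_smul, (hnpos k).ne']
  obtain ⟨d, hd, φ, hφ, hlim⟩ := (isCompact_sphere _ _).tendsto_subseq hsph
  have hd0 : d ≠ 0 := by
    rintro rfl
    simp at hd
  obtain ⟨u, v, huv, hpos⟩ := exists_pos_slope hW hgen hd0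
  set s := (Finset.univ : Finset (Fin n)).offDiag with hs
  set L : (Fin n → ℝ) × (Fin n → ℝ) → ℝ := fun η => ∑ p ∈ s,
    (η.1 p.1 * (Real.log (u p) - Real.log (W p.1 p.2)) +
      η.2 p.2 * (Real.log (1 - v p) - Real.log (1 - W p.1 p.2))) with hL
  set C := ∑ p ∈ s, Real.log (v p - u p) with hC
  have hLcont : Continuous L := by
    simp only [hL]
    fun_prop
  have hLsmul : ∀ (r : ℝ) η, L (r • η) = r * L η := fun r η => by
    simp only [hL, Finset.mul_sum, Prod.smul_fst, Prod.smul_snd, Pi.smul_apply, smul_eq_mul]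
    exact Finset.sum_congr rfl fun p _ => by ring
  have hLle : ∀ η ∈ parameterSpace n, L η + C ≤ negLogLik W η := fun η hη => by
    simp only [hL, hC, negLogLik]
    rw [← Finset.sum_add_distrib]
    refine Finset.sum_le_sum fun p hp => ?_
    obtain ⟨h1, h2, h3⟩ := huv p hp
    have := le_log_beta_of_lt (hη.1 p.1) (hη.2 p.2) h1 h2 h3
    simp only [edgeLoss]
    linarith
  have hbound : ∀ k, L (‖θ k‖⁻¹ • θ k) ≤ |c - C| / ((k : ℝ) + 1) := fun k => by
    have h1 : L (θ k) ≤ |c - C| :=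
      (by linarith [hLle _ (hθ k), hθc k] : L (θ k) ≤ c - C).trans (le_abs_self _)
    rw [hLsmul, inv_mul_eq_div]
    refine (div_le_div_of_nonneg_right h1 (hnpos k).le).trans ?_
    exact div_le_div_of_nonneg_left (abs_nonneg _) (by positivity) (hθn k).le
  have hzero : Filter.Tendsto (fun k : ℕ => |c - C| / ((k : ℝ) + 1)) Filter.atTop (nhds 0) := by
    simpa [div_eq_mul_inv] using
      tendsto_one_div_add_atTop_nhds_zero_nat.const_mul |c - C|
  have hlimL := (hLcont.tendsto d).comp hlim
  have : L d ≤ 0 := le_of_tendsto_of_tendsto' hlimL (hzero.comp hφ.tendsto_atTop)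
    fun k => hbound (φ k)
  exact absurd hpos (not_lt.2 this)

theorem continuousOn_negLogLik {n : ℕ} (W : Fin n → Fin n → ℝ) :
    ContinuousOn (negLogLik W) (parameterSpace n) := by
  intro θ hθ
  refine ContinuousAt.continuousWithinAt (tendsto_finsetSum _ fun p _ => ?_)
  have hG : ∀ x : ℝ, 0 < x → ContinuousAt Real.Gamma x := fun x hx =>
    (Real.differentiableAt_Gamma fun m => by
      have : (0 : ℝ) ≤ m := m.cast_nonneg
      linarith).continuousAt
  have ha := hθ.1 p.1
  have hb := hθ.2 p.2
  have c1 : ContinuousAt (fun η : (Fin n → ℝ) × (Fin n → ℝ) => η.1 p.1) θ := by fun_prop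
  have c2 : ContinuousAt (fun η : (Fin n → ℝ) × (Fin n → ℝ) => η.2 p.2) θ := by fun_prop
  have g1 := ContinuousAt.comp_of_eq (hG _ ha) c1 rfl
  have g2 := ContinuousAt.comp_of_eq (hG _ hb) c2 rfl
  have g3 := ContinuousAt.comp_of_eq (hG _ (add_pos ha hb)) (c1.add c2) rfl
  have gB := ((g1.mul g2).div g3 (Real.Gamma_pos_of_pos (add_pos ha hb)).ne').log
    (beta_pos ha hb).ne'
  exact (gB.sub (c1.mul_const _)).sub (c2.mul_const _)

/-- On bounded sets of parameters the loss of one pair is bounded below, and it tends to infinity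
when one of its two parameters tends to `0`. -/
theorem le_edgeLoss {w a b M : ℝ} (hw : w ∈ Set.Ioo (0 : ℝ) 1) (ha : 0 < a) (hb : 0 < b)
    (haM : a ≤ M) (hbM : b ≤ M) :
    -Real.log a - 2 * M * Real.log 2 ≤ edgeLoss w (a, b) ∧
      -Real.log b - 2 * M * Real.log 2 ≤ edgeLoss w (a, b) := by
  have h1 := neg_log_le_log_beta ha hb
  have h2 := neg_log_le_log_beta hb ha
  rw [beta_comm] at h2
  have l2 : 0 < Real.log 2 := Real.log_pos (by norm_num)
  have l3 : a * Real.log w ≤ 0 :=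
    mul_nonpos_of_nonneg_of_nonpos ha.le (Real.log_nonpos hw.1.le hw.2.le)
  have l4 : b * Real.log (1 - w) ≤ 0 := mul_nonpos_of_nonneg_of_nonpos hb.le
    (Real.log_nonpos (by linarith [hw.2]) (by linarith [hw.1]))
  have l5 : (a + b) * Real.log 2 ≤ 2 * M * Real.log 2 :=
    mul_le_mul_of_nonneg_right (by linarith) l2.le
  simp only [edgeLoss]
  constructor <;> linarith

/-- On bounded sets, parameters in a sublevel set stay away from the boundary of the parameter
space. -/
theorem exists_pos_le_of_negLogLik_le {n : ℕ} (hn : 2 ≤ n) {W : Fin n → Fin n → ℝ}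
    (hW : ∀ i j, i ≠ j → W i j ∈ Set.Ioo (0 : ℝ) 1) (c M : ℝ) :
    ∃ δ : ℝ, 0 < δ ∧ ∀ θ ∈ parameterSpace n, (∀ i, θ.1 i ≤ M) → (∀ j, θ.2 j ≤ M) →
      negLogLik W θ ≤ c → (∀ i, δ ≤ θ.1 i) ∧ ∀ j, δ ≤ θ.2 j := by
  have : Nontrivial (Fin n) := Fin.nontrivial_iff_two_le.2 hn
  set s := (Finset.univ : Finset (Fin n)).offDiag with hs
  -- `-K` is a lower bound for the loss of each single pair
  set K := Real.log M + 2 * M * Real.log 2 with hK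
  set N := (s.card : ℝ)
  refine ⟨Real.exp (-(c + (N - 1) * K + 2 * M * Real.log 2)), Real.exp_pos _,
    fun θ hθ h1 h2 hc => ?_⟩
  have hlow : ∀ p ∈ s, -K ≤ edgeLoss (W p.1 p.2) (θ.1 p.1, θ.2 p.2) := fun p hp => by
    have hp' := (Finset.mem_offDiag.1 hp).2.2
    have := (le_edgeLoss (hW _ _ hp') (hθ.1 p.1) (hθ.2 p.2) (h1 _) (h2 _)).1
    have := Real.log_le_log (hθ.1 p.1) (h1 p.1)
    linarith
  have hup : ∀ p ∈ s, edgeLoss (W p.1 p.2) (θ.1 p.1, θ.2 p.2) ≤ c + (N - 1) * K := fun p hp => by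
    have e := Finset.add_sum_erase s (fun p => edgeLoss (W p.1 p.2) (θ.1 p.1, θ.2 p.2)) hp
    have e' : (s.erase p).card • (-K) ≤
        ∑ q ∈ s.erase p, edgeLoss (W q.1 q.2) (θ.1 q.1, θ.2 q.2) :=
      Finset.card_nsmul_le_sum _ _ _ fun q hq => hlow q (Finset.mem_of_mem_erase hq)
    rw [Finset.card_erase_of_mem hp, nsmul_eq_mul,
      Nat.cast_sub (Finset.card_pos.2 ⟨p, hp⟩), Nat.cast_one] at e'
    change negLogLik W θ ≤ c at hc
    simp only [negLogLik] at hc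
    linarith
  have hexp : ∀ x, 0 < x → -Real.log x - 2 * M * Real.log 2 ≤ c + (N - 1) * K →
      Real.exp (-(c + (N - 1) * K + 2 * M * Real.log 2)) ≤ x := fun x hx h =>
    (Real.le_log_iff_exp_le hx).1 (by linarith)
  refine ⟨fun i => ?_, fun j => ?_⟩
  · obtain ⟨j, hj⟩ := exists_ne i
    have hp : (i, j) ∈ s := by simp [hs, hj.symm]
    exact hexp _ (hθ.1 i) ((le_edgeLoss (hW _ _ hj.symm) (hθ.1 i) (hθ.2 j) (h1 _)
      (h2 _)).1.trans (hup _ hp))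
  · obtain ⟨i, hi⟩ := exists_ne j
    have hp : (i, j) ∈ s := by simp [hs, hi]
    exact hexp _ (hθ.2 j) ((le_edgeLoss (hW _ _ hi) (hθ.1 i) (hθ.2 j) (h1 _)
      (h2 _)).2.trans (hup _ hp))

theorem exists_isMinOn_negLogLik {n : ℕ} (hn : 2 ≤ n) {W : Fin n → Fin n → ℝ}
    (hW : ∀ i j, i ≠ j → W i j ∈ Set.Ioo (0 : ℝ) 1) (hgen : HasGenericTriangle W) :
    ∃ θ ∈ parameterSpace n, IsMinOn (negLogLik W) (parameterSpace n) θ := by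
  set θ₀ : (Fin n → ℝ) × (Fin n → ℝ) := (fun _ => 1, fun _ => 1) with hθ₀
  have hθ₀mem : θ₀ ∈ parameterSpace n := ⟨fun _ => one_pos, fun _ => one_pos⟩
  obtain ⟨M, hM⟩ := exists_norm_le_of_negLogLik_le hW hgen (negLogLik W θ₀)
  obtain ⟨δ, hδ, hδle⟩ := exists_pos_le_of_negLogLik_le hn hW (negLogLik W θ₀) M
  set K : Set ((Fin n → ℝ) × (Fin n → ℝ)) :=
    Set.Icc (fun _ => δ, fun _ => δ) (fun _ => M, fun _ => M) with hK
  have hKsub : K ⊆ parameterSpace n := fun θ hθ =>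
    ⟨fun i => hδ.trans_le (hθ.1.1 i), fun j => hδ.trans_le (hθ.1.2 j)⟩
  have hsub : ∀ θ ∈ parameterSpace n, negLogLik W θ ≤ negLogLik W θ₀ → θ ∈ K :=
    fun θ hθ hle => by
      have hn1 : ∀ i, θ.1 i ≤ M := fun i => (le_abs_self _).trans
        ((norm_le_pi_norm θ.1 i).trans ((norm_fst_le θ).trans (hM θ hθ hle)))
      have hn2 : ∀ j, θ.2 j ≤ M := fun j => (le_abs_self _).trans
        ((norm_le_pi_norm θ.2 j).trans ((norm_snd_le θ).trans (hM θ hθ hle)))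
      obtain ⟨d1, d2⟩ := hδle θ hθ hn1 hn2 hle
      exact ⟨⟨d1, d2⟩, ⟨hn1, hn2⟩⟩
  obtain ⟨θ, hθK, hmin⟩ := (isCompact_Icc (a := ((fun _ => δ, fun _ => δ) :
    (Fin n → ℝ) × (Fin n → ℝ))) (b := (fun _ => M, fun _ => M))).exists_isMinOn
    ⟨θ₀, hsub θ₀ hθ₀mem le_rfl⟩ ((continuousOn_negLogLik W).mono hKsub)
  refine ⟨θ, hKsub hθK, fun η hη => ?_⟩
  by_cases h : negLogLik W η ≤ negLogLik W θ₀
  · exact hmin (hsub η hη h)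
  · exact (hmin (hsub θ₀ hθ₀mem le_rfl)).trans (not_le.1 h).le

theorem existsUnique_solvesMLEquations {n : ℕ} (hn : 2 ≤ n) {W : Fin n → Fin n → ℝ}
    (hW : ∀ i j, i ≠ j → W i j ∈ Set.Ioo (0 : ℝ) 1) (hgen : HasGenericTriangle W) :
    ∃! θ : (Fin n → ℝ) × (Fin n → ℝ), SolvesMLEquations W θ.1 θ.2 := by
  obtain ⟨θ, hθ, hmin⟩ := exists_isMinOn_negLogLik hn hW hgen
  refine ⟨θ, (solvesMLEquations_iff_isMinOn hn W hθ).2 hmin, fun η hη => ?_⟩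
  have hηmem : η ∈ parameterSpace n := ⟨hη.1, hη.2.1⟩
  exact (strictConvexOn_negLogLik hn W).eq_of_isMinOn
    ((solvesMLEquations_iff_isMinOn hn W hηmem).1 hη) hmin hηmem hθ

/-! ### Genericity of the random weights -/

theorem betaMeasure_absolutelyContinuous (a b : ℝ) : betaMeasure a b ≪ volume :=
  withDensity_absolutelyContinuous _ _

instance nullSingletonClass_betaMeasure (a b : ℝ) : NullSingletonClass (betaMeasure a b) :=
  ⟨fun x => betaMeasure_absolutelyContinuous a b (measure_singleton x)⟩

theorem ae_mem_Ioo_betaMeasure (a b : ℝ) : ∀ᵐ x ∂betaMeasure a b, x ∈ Set.Ioo (0 : ℝ) 1 := by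
  have hm : Measurable (betaPDF a b) := (measurable_betaPDFReal a b).ennreal_ofReal
  rw [betaMeasure, ae_withDensity_iff hm]
  refine ae_of_all _ fun x hx => ?_
  by_contra hcon
  exact hx (by rw [betaPDF_eq, if_neg (by simpa using hcon), ENNReal.ofReal_zero])

theorem ae_ne_of_indepFun {Ω : Type*} [MeasurableSpace Ω] {μ : Measure Ω} [IsProbabilityMeasure μ]
    {X Y : Ω → ℝ} (hX : AEMeasurable X μ) (hY : AEMeasurable Y μ) (h : IndepFun X Y μ)
    [NullSingletonClass (μ.map X)] : ∀ᵐ ω ∂μ, X ω ≠ Y ω := by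
  have hd : MeasurableSet {p : ℝ × ℝ | p.1 = p.2} := measurableSet_eq_fun measurable_fst
    measurable_snd
  have := Measure.isProbabilityMeasure_map hX
  have := Measure.isProbabilityMeasure_map hY
  have hprod := (indepFun_iff_map_prod_eq_prod_map_map hX hY).1 h
  have h0 : μ.map (fun ω => (X ω, Y ω)) {p : ℝ × ℝ | p.1 = p.2} = 0 := by
    rw [hprod, Measure.prod_apply_symm hd]
    have : ∀ y : ℝ, (fun x : ℝ => (x, y)) ⁻¹' {p : ℝ × ℝ | p.1 = p.2} = {y} := fun y => by
      ext x; simp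
    simp [this]
  rw [Measure.map_apply_of_aemeasurable (hX.prodMk hY) hd] at h0
  rw [ae_iff]
  simpa using h0

/-- Given the other weights, at most one value of `w i j` balances the two orientations of the
triangle `i, j, k`; as `w i j` is independent of them and has no atoms, this value has
probability zero. -/
theorem ae_hasGenericTriangle {Ω : Type*} [MeasurableSpace Ω] {μ : Measure Ω}
    [IsProbabilityMeasure μ] {n : ℕ} (hn : 3 ≤ n) {a b : Fin n → ℝ}
    {w : Fin n → Fin n → Ω → ℝ} (hw : IsBetaDigraph μ a b w)
    (hmem : ∀ᵐ ω ∂μ, ∀ i j, i ≠ j → w i j ω ∈ Set.Ioo (0 : ℝ) 1) :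
    ∀ᵐ ω ∂μ, HasGenericTriangle (fun i j => w i j ω) := by
  obtain ⟨i, j, k, hij, hjk, hki⟩ : ∃ i j k : Fin n, i ≠ j ∧ j ≠ k ∧ k ≠ i :=
    ⟨⟨0, by omega⟩, ⟨1, by omega⟩, ⟨2, by omega⟩, by simp, by simp, by simp⟩
  set e : {p : Fin n × Fin n // p.1 ≠ p.2} := ⟨(i, j), hij⟩ with he
  set T : Finset {p : Fin n × Fin n // p.1 ≠ p.2} := Finset.univ.erase e with hT
  have hmeas : ∀ p : {p : Fin n × Fin n // p.1 ≠ p.2}, AEMeasurable (w p.1.1 p.1.2) μ :=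
    fun p => (hw.law _ _ p.2).aemeasurable
  have hind := hw.indep.indepFun_finset₀ {e} T (by simp [hT]) hmeas
  have mem : ∀ x y (h : x ≠ y), (x, y) ≠ (i, j) →
      (⟨(x, y), h⟩ : {p : Fin n × Fin n // p.1 ≠ p.2}) ∈ T := fun x y h hne => by
    simpa [hT, he] using hne
  -- the value that `w i j` must take for the two orientations of the triangle to balance
  set g : (T → ℝ) → ℝ := fun t =>
    let wjk := t ⟨⟨(j, k), hjk⟩, mem _ _ _ (by simp [hij.symm])⟩
    let wki := t ⟨⟨(k, i), hki⟩, mem _ _ _ (by simp [hki])⟩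
    let wik := t ⟨⟨(i, k), hki.symm⟩, mem _ _ _ (by simp [hjk.symm])⟩
    let wkj := t ⟨⟨(k, j), hjk.symm⟩, mem _ _ _ (by simp [hki])⟩
    let wji := t ⟨⟨(j, i), hij.symm⟩, mem _ _ _ (by simp [hij.symm])⟩
    wik * wkj * wji * ((1 - wjk) * (1 - wki)) /
      (wjk * wki * ((1 - wik) * (1 - wkj) * (1 - wji)) +
        wik * wkj * wji * ((1 - wjk) * (1 - wki))) with hg
  have hgm : Measurable g := by
    simp only [hg]
    fun_prop
  have hTm : AEMeasurable (fun ω (p : T) => w p.1.1.1 p.1.1.2 ω) μ :=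
    aemeasurable_pi_lambda _ fun p => hmeas p.1
  have hind' : IndepFun (w i j) (fun ω => g (fun p : T => w p.1.1.1 p.1.1.2 ω)) μ :=
    hind.comp (φ := fun t : ({e} : Finset {p : Fin n × Fin n // p.1 ≠ p.2}) → ℝ =>
      t ⟨e, Finset.mem_singleton_self e⟩) (by fun_prop) hgm
  have : NullSingletonClass (μ.map (w i j)) := by
    rw [(hw.law i j hij).map_eq]
    infer_instance
  filter_upwards [hmem, ae_ne_of_indepFun (hmeas e) (hgm.comp_aemeasurable hTm) hind']
    with ω h01 hne
  refine ⟨i, j, k, hij, hjk, hki, fun heq => hne ?_⟩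
  obtain ⟨p1, q1⟩ := h01 j k hjk
  obtain ⟨p2, q2⟩ := h01 k i hki
  obtain ⟨p3, q3⟩ := h01 i k hki.symm
  obtain ⟨p4, q4⟩ := h01 k j hjk.symm
  obtain ⟨p5, q5⟩ := h01 j i hij.symm
  rw [← sub_pos] at q1 q2 q3 q4 q5
  dsimp only at heq
  simp only [hg, he, Function.comp_apply]
  rw [eq_div_iff (by positivity)]
  linear_combination heq

theorem theorem1 {Ω : Type*} [MeasurableSpace Ω] (μ : Measure Ω) [IsProbabilityMeasure μ]
    (n : ℕ) (hn : 3 ≤ n) (a b : Fin n → ℝ) (ha : ∀ i, 0 < a i) (hb : ∀ j, 0 < b j)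
    (w : Fin n → Fin n → Ω → ℝ) (hw : IsBetaDigraph μ a b w) :
    ∀ᵐ ω ∂μ, ∃! θ : (Fin n → ℝ) × (Fin n → ℝ),
      SolvesMLEquations (fun i j => w i j ω) θ.1 θ.2 := by
  have hmem : ∀ᵐ ω ∂μ, ∀ i j, i ≠ j → w i j ω ∈ Set.Ioo (0 : ℝ) 1 := by
    simp only [ae_all_iff]
    intro i j hij
    have h := ae_mem_Ioo_betaMeasure (a i) (b j)
    rw [← (hw.law i j hij).map_eq] at h
    exact ae_of_ae_map (hw.law i j hij).aemeasurable h
  filter_upwards [hmem, ae_hasGenericTriangle hn hw hmem] with ω h1 h2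
  exact existsUnique_solvesMLEquations (by omega) h1 h2
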